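/- Let $\mathcal H,\mathcal K$ be finite-dimensional complex Hilbert spaces, written as $\mathbb C^n,\mathbb C^m$ in orthonormal bases, so that $\mathcal B(\mathcal H)$, $\mathcal B(\mathcal K)$ are matrix algebras. A quantum channel is a completely positive trace preserving linear map; $\Phi^\dagger$ is the adjoint of $\Phi$ for the Hilbert–Schmidt inner product $\langle A,B\rangle=\operatorname{tr}(A^*B)$. A function $g:(0,\infty)\to(0,\infty)$ is operator anti-monotone if $A\le B$ implies $g(B)\le g(A)$ for all positive definite matrices $A,B$ of every size. It defines the monotone metric $$\gamma^g_\rho(A)=\langle A,\,g(L_\rho R_\rho^{-1})R_\rho^{-1}(A)\rangle=\sum_{i,j:\ \lambda_i,\lambda_j>0}\lambda_j^{-1}g(\lambda_i/\lambda_j)\,|\langle\phi_i,A\phi_j\rangle|^2 ,\qquad \rho=\sum_i\lambda_i|\phi_i\rangle\langle\phi_i| ,$$ where $L_\rho,R_\rho$ are left and right multiplication by $\rho$, taken on the support of $\rho$ if $\rho$ is singular. Write $g(x)=c+\int_{[0,\infty)}\frac{1}{s+x}\,d\nu_g(s)$ with $c\ge 0$ and a positive measure $\nu_g$; the metric $\gamma^g$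 is called regular if Lebesgue measure on $(0,\infty)$ is absolutely continuous with respect to $\nu_g$. Call $g$ symmetric and normalized if $g(x^{-1})=x\,g(x)$ for all $x>0$ and $g(1)=1$. For a positive definite density operator $\rho$ on $\mathcal H$, a channel $\Phi:\mathcal B(\mathcal H)\to\mathcal B(\mathcal K)$ and $t\in\mathbb R$, the rotated Petz map is $$\mathcal R^t_{\rho,\Phi}(X)=\rho^{\frac12-it}\,\Phi^\dagger\big(\Phi(\rho)^{-\frac12+it}\,X\,\Phi(\rho)^{-\frac12-it}\big)\,\rho^{\frac12+it},$$ where powers of $\Phi(\rho)$ are taken on its support and are zero on its kernel. **Theorem.** Let $\rho$ be a positive definite density operator on $\mathcal H$ and $\Phi:\mathcal B(\mathcal H)\to\mathcal B(\mathcal K)$ a quantum channel. Then for every $A\in\mathcal B(\mathcal H)$ the following are equivalent: 1. $\gamma^g_\rho(A)=\gamma^g_{\Phi(\rho)}(\Phi(A))$ for all monotone metrics $\gamma^g$; 2. the same equality for all monotone metrics $\gamma^g$ with $g$ symmetric and normalized; 3. the same equality for some regular monotone metric $\gamma^g$; 4. the same equality for some regular monotone metric $\gamma^g$ with $g$ symmetric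 and normalized; 5. $A=\mathcal R^t_{\rho,\Phi}(\Phi(A))$ for some $t\in\mathbb R$; 6. $A=\mathcal R^t_{\rho,\Phi}(\Phi(A))$ for all $t\in\mathbb R$; 7. there is a quantum channel $\mathcal R:\mathcal B(\mathcal K)\to\mathcal B(\mathcal H)$ with $\mathcal R(\Phi(\rho))=\rho$ and $\mathcal R(\Phi(A))=A$. -/

import Mathlib

open Matrix MeasureTheory
open scoped ComplexOrder

namespace QuantumMetric

section Channels

variable {n m : Type*} [Fintype n] [DecidableEq n] [Fintype m] [DecidableEq m]

/-- A faithful density matrix: positive definite with trace one. -/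
structure IsFaithfulState (ρ : Matrix n n ℂ) : Prop where
  posDef : ρ.PosDef
  trace_eq_one : ρ.trace = 1

/-- The ampliation `id_k ⊗ Φ`, acting blockwise on `k × k` block matrices with blocks in
`M_n(ℂ)`. -/
def ampliation (k : ℕ) (Φ : Matrix n n ℂ →ₗ[ℂ] Matrix m m ℂ)
    (X : Matrix (Fin k × n) (Fin k × n) ℂ) : Matrix (Fin k × m) (Fin k × m) ℂ :=
  Matrix.of fun p q => Φ (Matrix.of fun a b => X (p.1, a) (q.1, b)) p.2 q.2

/-- A quantum channel: a completely positive trace preserving linear map. -/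
structure IsQuantumChannel (Φ : Matrix n n ℂ →ₗ[ℂ] Matrix m m ℂ) : Prop where
  completelyPositive : ∀ (k : ℕ) (X : Matrix (Fin k × n) (Fin k × n) ℂ),
    X.PosSemidef → (ampliation k Φ X).PosSemidef
  tracePreserving : ∀ X : Matrix n n ℂ, (Φ X).trace = X.trace

/-- The adjoint `Φ†` of `Φ` for the Hilbert-Schmidt inner product `⟨A, B⟩ = tr(A* B)`, given by
its coefficients `⟨E_ij, Φ†(X)⟩ = ⟨Φ(E_ij), X⟩` in the matrix units. -/
def hsAdjoint (Φ : Matrix n n ℂ →ₗ[ℂ] Matrix m m ℂ) : Matrix m m ℂ →ₗ[ℂ] Matrix n n ℂ where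
  toFun X := Matrix.of fun i j => ((Φ (Matrix.single i j 1))ᴴ * X).trace
  map_add' X Y := by
    ext i j
    simp [Matrix.mul_add]
  map_smul' c X := by
    ext i j
    simp

/-- The defining property `⟨Φ(A), X⟩ = ⟨A, Φ†(X)⟩` of the adjoint. -/
theorem trace_hsAdjoint (Φ : Matrix n n ℂ →ₗ[ℂ] Matrix m m ℂ) (A : Matrix n n ℂ)
    (X : Matrix m m ℂ) : ((Φ A)ᴴ * X).trace = (Aᴴ * hsAdjoint Φ X).trace := by
  conv_lhs => rw [Matrix.matrix_eq_sum_single A]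
  have h : ∀ i j, Matrix.single i j (A i j) = A i j • Matrix.single i j (1 : ℂ) := by
    intro i j; simp [Matrix.smul_single]
  simp only [h, map_sum, map_smul, Matrix.conjTranspose_sum, Matrix.conjTranspose_smul,
    Matrix.sum_mul, Matrix.trace_sum, Matrix.smul_mul, Matrix.trace_smul]
  simp only [Matrix.trace, Matrix.diag, Matrix.mul_apply (M := Aᴴ), hsAdjoint,
    Matrix.conjTranspose_apply, smul_eq_mul, LinearMap.coe_mk, AddHom.coe_mk, Matrix.of_apply]
  rw [Finset.sum_comm]

end Channels

section SpectralCalculus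

variable {n m : Type*} [Fintype n] [DecidableEq n] [Fintype m] [DecidableEq m]

open Classical in
/-- The power `ρ ^ z` of a positive semidefinite matrix, taken on the support of `ρ` and zero on
its kernel: if `ρ = ∑ i, λ i • |φ i⟩⟨φ i|`, then `ρ ^ z = ∑_{λ i > 0} (λ i) ^ z • |φ i⟩⟨φ i|`.
(The value for a matrix that is not Hermitian is irrelevant.) -/
noncomputable def matPow (ρ : Matrix n n ℂ) (z : ℂ) : Matrix n n ℂ :=
  if h : ρ.IsHermitian then
    (h.eigenvectorUnitary : Matrix n n ℂ) *
      Matrix.diagonal (fun i => if 0 < h.eigenvalues i then (h.eigenvalues i : ℂ) ^ z else 0) *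
      (h.eigenvectorUnitary : Matrix n n ℂ)ᴴ
  else 0

/-- The rotated Petz map
`R^t(X) = ρ^{1/2 - it} Φ†(Φ(ρ)^{-1/2 + it} X Φ(ρ)^{-1/2 - it}) ρ^{1/2 + it}`. -/
noncomputable def rotatedPetz (ρ : Matrix n n ℂ) (Φ : Matrix n n ℂ →ₗ[ℂ] Matrix m m ℂ) (t : ℝ)
    (X : Matrix m m ℂ) : Matrix n n ℂ :=
  matPow ρ (1 / 2 - t * Complex.I) *
    hsAdjoint Φ (matPow (Φ ρ) (-1 / 2 + t * Complex.I) * X *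
      matPow (Φ ρ) (-1 / 2 - t * Complex.I)) *
    matPow ρ (1 / 2 + t * Complex.I)

open Classical in
/-- The superoperator `J_ρ^g = g(L_ρ R_ρ⁻¹) R_ρ⁻¹`, where `L_ρ` and `R_ρ` are left and right
multiplication by `ρ`, through the joint spectral decomposition of the commuting positive
operators `L_ρ` and `R_ρ`: if `ρ = ∑ i, λ i • |φ i⟩⟨φ i|`, then
`J_ρ^g(B) = ∑_{i, j} (λ j)⁻¹ g(λ i / λ j) ⟨φ i, B φ j⟩ |φ i⟩⟨φ j|`.
For a singular `ρ` everything is done on the support of `ρ`, i.e. the sum is over `λ i, λ j > 0`.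
(The value for a matrix that is not Hermitian is irrelevant.) -/
noncomputable def metricOperator (g : ℝ → ℝ) (ρ B : Matrix n n ℂ) : Matrix n n ℂ :=
  if h : ρ.IsHermitian then
    (h.eigenvectorUnitary : Matrix n n ℂ) *
      (Matrix.of fun i j =>
        (if 0 < h.eigenvalues i ∧ 0 < h.eigenvalues j then
          (((h.eigenvalues j)⁻¹ * g (h.eigenvalues i / h.eigenvalues j) : ℝ) : ℂ) else 0) *
        ((h.eigenvectorUnitary : Matrix n n ℂ)ᴴ * B * (h.eigenvectorUnitary : Matrix n n ℂ)) i j) *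
      (h.eigenvectorUnitary : Matrix n n ℂ)ᴴ
  else 0

/-- The sesquilinear form `γ_ρ^g(A, B) = ⟨A, J_ρ^g(B)⟩ = tr(A* J_ρ^g(B))`. -/
noncomputable def metricForm (g : ℝ → ℝ) (ρ A B : Matrix n n ℂ) : ℂ :=
  (Aᴴ * metricOperator g ρ B).trace

/-- The quadratic form `γ_ρ^g(A) = γ_ρ^g(A, A)`. -/
noncomputable def metric (g : ℝ → ℝ) (ρ A : Matrix n n ℂ) : ℂ :=
  metricForm g ρ A A

end SpectralCalculus

section Functions

/-- `g : (0, ∞) → (0, ∞)` is operator anti-monotone (`g` is only looked at on `(0, ∞)`):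
`A ≤ B` implies `g(B) ≤ g(A)` for all positive definite matrices of all sizes. These are the
functions `g` that give the monotone metrics `γ^g`. -/
structure IsMonotoneMetricFunction (g : ℝ → ℝ) : Prop where
  pos : ∀ x : ℝ, 0 < x → 0 < g x
  operatorAntitone : ∀ (k : ℕ) (A B : Matrix (Fin k) (Fin k) ℂ), A.PosDef → B.PosDef →
    (B - A).PosSemidef → (cfc g A - cfc g B).PosSemidef

/-- The symmetry and normalization `g(1/x) = x g(x)`, `g(1) = 1`; the symmetry means
`γ_ρ(A, B) = γ_ρ(B*, A*)`. -/
structure IsSymmetricNormalized (g : ℝ → ℝ) : Prop where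
  symm : ∀ x : ℝ, 0 < x → g x⁻¹ = x * g x
  map_one : g 1 = 1

/-- The integral representation `g(x) = c + ∫_{[0, ∞)} 1 / (s + x) dν(s)` of a positive operator
anti-monotone function on `(0, ∞)`. The pair `(c, ν)` is unique; the constant `c ≥ 0` is the mass
of the representing measure at `s = ∞`. -/
structure IsRepresentedBy (g : ℝ → ℝ) (c : ℝ) (ν : Measure ℝ) : Prop where
  nonneg : 0 ≤ c
  support : ν (Set.Iio 0) = 0
  integrable : ∀ x : ℝ, 0 < x → Integrable (fun s => 1 / (s + x)) ν
  eq : ∀ x : ℝ, 0 < x → g x = c + ∫ s, 1 / (s + x) ∂ν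

/-- `g` is regular: Lebesgue measure on `(0, ∞)` is absolutely continuous with respect to the
representing measure `ν_g` of `g`. -/
def IsRegular (g : ℝ → ℝ) : Prop :=
  ∃ (c : ℝ) (ν : Measure ℝ), IsRepresentedBy g c ν ∧ volume.restrict (Set.Ioi (0 : ℝ)) ≪ ν

end Functions

end QuantumMetric

/-! Everything reduces to the resolvent metrics `⟨A, (s R_ρ + L_ρ)⁻¹ A⟩`: a metric whose `g` has an
integral representation is a positive mixture of them, the constant `c` contributing `R_ρ⁻¹` (the
case `s = ∞`).

Write `σ = Φ ρ`. The Kadison–Schwarz inequality for the unital map `Φ†` says that the forms of `a R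
+ b L` do not grow when pulled back along `Φ†`. Completing the square turns this into monotonicity
of the inverse forms, with a remainder: by `IsQuantumChannel.mulForm_sub_le` the loss bounds the
form of `Φ†((a R_σ + b L_σ)⁻¹ Φ(A)) - (a R_ρ + b L_ρ)⁻¹ A`. Equality therefore forces this
difference to vanish.

For a regular metric, equality forces this for almost every `s > 0`. Both sides see only finitely
many eigenvalue ratios, so partial fractions extend the identity from the functions `1 / (s + x)` to
every function `f`; this is `IsSufficient`. Taking `f = x ^ (-1/2 + it)` gives recovery by every
rotated Petz map, and taking `f = g` gives equality for every metric, with no integral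
representation of `g`.

Conversely, a rotated Petz map recovering `A` is completed to a channel recovering `ρ` and `A`
(`recoveryMap`). Any such channel forces equality of all resolvent forms, by monotonicity under `Φ`
and then under the recovery. The function `x ^ (-1/2)` shows that regular symmetric normalized
metrics exist. -/

namespace QuantumMetric

set_option linter.unusedSectionVars false

/-! ### Completely positive maps, their adjoints, and the Schwarz inequality -/

section CompletelyPositive

variable {n m l : Type*} [Fintype n] [DecidableEq n] [Fintype m] [DecidableEq m]
  [Fintype l] [DecidableEq l]

/-- Complete positivity: all ampliations preserve positive semidefiniteness. -/
def IsCompletelyPositive (Φ : Matrix n n ℂ →ₗ[ℂ] Matrix m m ℂ) : Prop :=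
  ∀ (k : ℕ) (X : Matrix (Fin k × n) (Fin k × n) ℂ), X.PosSemidef → (ampliation k Φ X).PosSemidef

theorem IsCompletelyPositive.comp {Ψ : Matrix m m ℂ →ₗ[ℂ] Matrix l l ℂ}
    {Φ : Matrix n n ℂ →ₗ[ℂ] Matrix m m ℂ} (hΨ : IsCompletelyPositive Ψ)
    (hΦ : IsCompletelyPositive Φ) : IsCompletelyPositive (Ψ ∘ₗ Φ) :=
  fun k X hX => hΨ k _ (hΦ k X hX)

theorem IsCompletelyPositive.add {Ψ Φ : Matrix n n ℂ →ₗ[ℂ] Matrix m m ℂ}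
    (hΨ : IsCompletelyPositive Ψ) (hΦ : IsCompletelyPositive Φ) :
    IsCompletelyPositive (Ψ + Φ) :=
  fun k X hX => (hΨ k X hX).add (hΦ k X hX)

/-- The map `X ↦ K X K*`. -/
def conjMap (K : Matrix m n ℂ) : Matrix n n ℂ →ₗ[ℂ] Matrix m m ℂ where
  toFun X := K * X * Kᴴ
  map_add' X Y := by simp [Matrix.mul_add, Matrix.add_mul]
  map_smul' c X := by simp

@[simp] theorem conjMap_apply (K : Matrix m n ℂ) (X : Matrix n n ℂ) :
    conjMap K X = K * X * Kᴴ := rfl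

theorem isCompletelyPositive_conjMap (K : Matrix m n ℂ) :
    IsCompletelyPositive (conjMap K) := by
  intro k X hX
  have h : ampliation k (conjMap K) X
      = Matrix.kroneckerMap (· * ·) (1 : Matrix (Fin k) (Fin k) ℂ) K * X *
        (Matrix.kroneckerMap (· * ·) (1 : Matrix (Fin k) (Fin k) ℂ) K)ᴴ := by
    ext ⟨p, a⟩ ⟨q, b⟩
    simp [ampliation, Matrix.mul_apply, Fintype.sum_prod_type, Matrix.one_apply, Finset.sum_mul,
      apply_ite, ite_mul]
  rw [h]
  exact hX.mul_mul_conjTranspose_same _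

/-- The map `X ↦ tr(X) τ`. -/
def traceMap (τ : Matrix m m ℂ) : Matrix n n ℂ →ₗ[ℂ] Matrix m m ℂ :=
  (Matrix.traceLinearMap n ℂ ℂ).smulRight τ

@[simp] theorem traceMap_apply (τ : Matrix m m ℂ) (X : Matrix n n ℂ) :
    traceMap τ X = X.trace • τ := rfl

/-- The ampliation is the partial trace over `n` followed by tensoring with `τ`, and both preserve
positivity. -/
theorem isCompletelyPositive_traceMap {τ : Matrix m m ℂ} (hτ : τ.PosSemidef) :
    IsCompletelyPositive (traceMap (n := n) τ) := by
  intro k X hX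
  have h : ampliation k (traceMap τ) X
      = Matrix.kroneckerMap (· * ·)
        (∑ c, X.submatrix (fun p : Fin k => (p, c)) (fun p : Fin k => (p, c))) τ := by
    ext ⟨p, a⟩ ⟨q, b⟩
    simp [ampliation, Matrix.trace, Matrix.sum_apply]
  rw [h]
  exact (posSemidef_sum _ fun c _ => hX.submatrix _).kronecker hτ

open scoped MatrixOrder Matrix.Norms.L2Operator in
theorem trace_mul_nonneg {P Q : Matrix n n ℂ} (hP : P.PosSemidef)
    (hQ : Q.PosSemidef) : 0 ≤ (P * Q).trace := by
  obtain ⟨B, rfl⟩ := CStarAlgebra.nonneg_iff_eq_star_mul_self.mp hP.nonneg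
  rw [Matrix.mul_assoc, Matrix.trace_mul_comm]
  exact (hQ.mul_mul_conjTranspose_same B).trace_nonneg

theorem dotProduct_mulVec_eq_trace (M : Matrix n n ℂ) (x : n → ℂ) :
    star x ⬝ᵥ (M *ᵥ x) = ((vecMulVec x (star x))ᴴ * M).trace := by
  simp only [dotProduct, mulVec, Matrix.trace, Matrix.diag, Matrix.mul_apply,
    Matrix.conjTranspose_apply, vecMulVec_apply, Finset.mul_sum]
  rw [Finset.sum_comm]
  refine Finset.sum_congr rfl fun i _ => Finset.sum_congr rfl fun j _ => ?_
  simp; ring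

theorem trace_ampliation_hsAdjoint (Φ : Matrix n n ℂ →ₗ[ℂ] Matrix m m ℂ) (k : ℕ)
    (A : Matrix (Fin k × n) (Fin k × n) ℂ) (X : Matrix (Fin k × m) (Fin k × m) ℂ) :
    ((ampliation k Φ A)ᴴ * X).trace = (Aᴴ * ampliation k (hsAdjoint Φ) X).trace := by
  have h := fun p q : Fin k => trace_hsAdjoint Φ (Matrix.of fun a b => A (p, a) (q, b))
    (Matrix.of fun a b => X (p, a) (q, b))
  simp only [Matrix.trace, Matrix.diag, Matrix.mul_apply, Matrix.conjTranspose_apply,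
    Fintype.sum_prod_type, ampliation, Matrix.of_apply] at h ⊢
  have h₁ : ∀ F : Fin k → m → Fin k → m → ℂ,
      ∑ p, ∑ a, ∑ q, ∑ b, F p a q b = ∑ p, ∑ q, ∑ a, ∑ b, F p a q b :=
    fun F => Finset.sum_congr rfl fun p _ => Finset.sum_comm
  have h₂ : ∀ F : Fin k → n → Fin k → n → ℂ,
      ∑ p, ∑ a, ∑ q, ∑ b, F p a q b = ∑ p, ∑ q, ∑ a, ∑ b, F p a q b :=
    fun F => Finset.sum_congr rfl fun p _ => Finset.sum_comm
  refine (h₁ _).trans (Eq.trans ?_ (h₂ _).symm)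
  exact Finset.sum_congr rfl fun p _ => Finset.sum_congr rfl fun q _ => h q p

/-- Over `ℂ`, a nonnegative quadratic form is automatically Hermitian. -/
theorem posSemidef_of_forall_nonneg {M : Matrix n n ℂ}
    (h : ∀ x : n → ℂ, 0 ≤ star x ⬝ᵥ (M *ᵥ x)) : M.PosSemidef := by
  rw [← Matrix.isPositive_toEuclideanLin_iff, LinearMap.isPositive_iff_complex]
  intro x
  have hx := h x.ofLp
  have e : inner ℂ (M.toEuclideanLin x) x = star (star x.ofLp ⬝ᵥ (M *ᵥ x.ofLp)) := by
    rw [EuclideanSpace.inner_eq_star_dotProduct, Matrix.star_dotProduct]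
    simp [dotProduct_comm]
  rw [e, (IsSelfAdjoint.of_nonneg hx).star_eq]
  obtain ⟨h1, h2⟩ := Complex.nonneg_iff.1 hx
  exact ⟨Complex.ext rfl (by simpa using h2), h1⟩

/-- The ampliation of `Φ†` is the adjoint of the ampliation of `Φ`. Tested on a rank one projection,
its value on `X` is thus the trace of a product of two positive matrices. -/
theorem IsCompletelyPositive.hsAdjoint {Φ : Matrix n n ℂ →ₗ[ℂ] Matrix m m ℂ}
    (hΦ : IsCompletelyPositive Φ) : IsCompletelyPositive (hsAdjoint Φ) := by
  intro k X hX
  refine posSemidef_of_forall_nonneg fun x => ?_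
  rw [dotProduct_mulVec_eq_trace, ← trace_ampliation_hsAdjoint]
  have h := hΦ k _ (posSemidef_vecMulVec_self_star x)
  rw [h.isHermitian.eq]
  exact trace_mul_nonneg h hX

theorem hsAdjoint_one {Φ : Matrix n n ℂ →ₗ[ℂ] Matrix m m ℂ}
    (h : ∀ X : Matrix n n ℂ, (Φ X).trace = X.trace) : hsAdjoint Φ 1 = 1 := by
  ext i j
  simp only [hsAdjoint, LinearMap.coe_mk, AddHom.coe_mk, Matrix.of_apply, Matrix.mul_one,
    Matrix.trace_conjTranspose, h]
  by_cases hij : i = j <;> simp [Matrix.one_apply, hij, Matrix.trace_single_eq_of_ne]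

/-- The blockwise image of `(X 1)* (X 1)`, whose blocks are `X* X`, `X*`, `X` and `1`. -/
theorem IsCompletelyPositive.block_posSemidef {Ψ : Matrix m m ℂ →ₗ[ℂ] Matrix n n ℂ}
    (hΨ : IsCompletelyPositive Ψ) (X : Matrix m m ℂ) :
    (Matrix.of fun p q : Fin 2 × n =>
      (if p.1 = 0 then (if q.1 = 0 then Ψ (Xᴴ * X) else Ψ Xᴴ)
        else (if q.1 = 0 then Ψ X else Ψ 1)) p.2 q.2).PosSemidef := by
  let G : Matrix m (Fin 2 × m) ℂ := Matrix.of fun a q => (if q.1 = 0 then X else 1) a q.2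
  have h := hΨ 2 _ (posSemidef_conjTranspose_mul_self G)
  convert h using 1
  ext ⟨p, a⟩ ⟨q, b⟩
  simp only [ampliation, Matrix.of_apply]
  have e : (Matrix.of fun a b => (Gᴴ * G) (p, a) (q, b))
      = if p = 0 then (if q = 0 then Xᴴ * X else Xᴴ) else (if q = 0 then X else 1) := by
    ext a b
    fin_cases p <;> fin_cases q <;>
      simp [G, Matrix.mul_apply, Matrix.one_apply, apply_ite, eq_comm]
  rw [e]
  fin_cases p <;> fin_cases q <;> simp

theorem IsCompletelyPositive.map_conjTranspose {Ψ : Matrix m m ℂ →ₗ[ℂ] Matrix n n ℂ}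
    (hΨ : IsCompletelyPositive Ψ) (X : Matrix m m ℂ) : Ψ Xᴴ = (Ψ X)ᴴ := by
  ext a b
  have h := (hΨ.block_posSemidef X).isHermitian.apply (0, a) (1, b)
  simpa using h.symm

/-- The Kadison–Schwarz inequality. -/
theorem IsCompletelyPositive.schwarz {Ψ : Matrix m m ℂ →ₗ[ℂ] Matrix n n ℂ}
    (hΨ : IsCompletelyPositive Ψ) (h1 : Ψ 1 = 1) (X : Matrix m m ℂ) :
    (Ψ (Xᴴ * X) - (Ψ X)ᴴ * Ψ X).PosSemidef := by
  -- Compressing the block matrix by the column `(1, -Ψ X)` produces the Schwarz defect.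
  let C : Matrix (Fin 2 × n) n ℂ :=
    Matrix.of fun p b => (if p.1 = 0 then (1 : Matrix n n ℂ) else -Ψ X) p.2 b
  have h := (hΨ.block_posSemidef X).conjTranspose_mul_mul_same C
  have e : Ψ (Xᴴ * X) - (Ψ X)ᴴ * Ψ X = (1ᴴ * Ψ (Xᴴ * X) + (-Ψ X)ᴴ * Ψ X) * 1
      + (1ᴴ * Ψ Xᴴ + (-Ψ X)ᴴ * Ψ 1) * (-Ψ X) := by
    rw [hΨ.map_conjTranspose X, h1]
    simp [sub_eq_add_neg]
  rw [e]
  convert h using 1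
  ext a b
  simp only [Matrix.mul_apply, Matrix.add_apply, Fintype.sum_prod_type, Fin.sum_univ_two, C,
    Matrix.conjTranspose_apply, Matrix.of_apply, if_true, one_ne_zero, if_false]

theorem trace_map_mul {Φ : Matrix n n ℂ →ₗ[ℂ] Matrix m m ℂ} {A : Matrix n n ℂ}
    (hA : A.IsHermitian) (hA' : (Φ A).IsHermitian) (X : Matrix m m ℂ) :
    (Φ A * X).trace = (A * hsAdjoint Φ X).trace := by
  simpa [hA.eq, hA'.eq] using trace_hsAdjoint Φ A X

end CompletelyPositive
-- Functional calculus of `L_ρ` and `R_ρ` in an eigenbasis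
section DoubleOperator

variable {n : Type*} [Fintype n] [DecidableEq n] {ρ : Matrix n n ℂ}

/-- The matrix of `B` in the chosen eigenbasis of `ρ`. -/
noncomputable def eigenCoord (h : ρ.IsHermitian) (B : Matrix n n ℂ) : Matrix n n ℂ :=
  (h.eigenvectorUnitary : Matrix n n ℂ)ᴴ * B * (h.eigenvectorUnitary : Matrix n n ℂ)

theorem eigenvectorUnitary_conjTranspose_mul (h : ρ.IsHermitian) :
    (h.eigenvectorUnitary : Matrix n n ℂ)ᴴ * (h.eigenvectorUnitary : Matrix n n ℂ) = 1 :=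
  Unitary.coe_star_mul_self _

theorem eigenvectorUnitary_mul_conjTranspose (h : ρ.IsHermitian) :
    (h.eigenvectorUnitary : Matrix n n ℂ) * (h.eigenvectorUnitary : Matrix n n ℂ)ᴴ = 1 :=
  Unitary.coe_mul_star_self _

theorem eigenCoord_conj (h : ρ.IsHermitian) (B : Matrix n n ℂ) :
    eigenCoord h ((h.eigenvectorUnitary : Matrix n n ℂ) * B *
      (h.eigenvectorUnitary : Matrix n n ℂ)ᴴ) = B := by
  have e := eigenvectorUnitary_conjTranspose_mul h
  simp only [eigenCoord, Matrix.mul_assoc, e, Matrix.mul_one]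
  rw [← Matrix.mul_assoc, e, Matrix.one_mul]

theorem conj_eigenCoord (h : ρ.IsHermitian) (B : Matrix n n ℂ) :
    (h.eigenvectorUnitary : Matrix n n ℂ) * eigenCoord h B *
      (h.eigenvectorUnitary : Matrix n n ℂ)ᴴ = B := by
  have e := eigenvectorUnitary_mul_conjTranspose h
  simp only [eigenCoord, Matrix.mul_assoc, e, Matrix.mul_one]
  rw [← Matrix.mul_assoc, e, Matrix.one_mul]

theorem eigenCoord_injective (h : ρ.IsHermitian) : Function.Injective (eigenCoord h) :=
  fun B C hBC => by rw [← conj_eigenCoord h B, hBC, conj_eigenCoord]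

theorem eigenCoord_mul (h : ρ.IsHermitian) (B C : Matrix n n ℂ) :
    eigenCoord h (B * C) = eigenCoord h B * eigenCoord h C := by
  have e := eigenvectorUnitary_mul_conjTranspose h
  simp only [eigenCoord, Matrix.mul_assoc]
  rw [← Matrix.mul_assoc (h.eigenvectorUnitary : Matrix n n ℂ)
    (h.eigenvectorUnitary : Matrix n n ℂ)ᴴ, e, Matrix.one_mul]

theorem eigenCoord_conjTranspose (h : ρ.IsHermitian) (B : Matrix n n ℂ) :
    eigenCoord h Bᴴ = (eigenCoord h B)ᴴ := by
  simp [eigenCoord, Matrix.mul_assoc]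

theorem trace_eigenCoord (h : ρ.IsHermitian) (B : Matrix n n ℂ) :
    (eigenCoord h B).trace = B.trace := by
  rw [eigenCoord, Matrix.trace_mul_comm, ← Matrix.mul_assoc,
    eigenvectorUnitary_mul_conjTranspose, Matrix.one_mul]

theorem eigenCoord_self (h : ρ.IsHermitian) :
    eigenCoord h ρ = Matrix.diagonal fun i => (h.eigenvalues i : ℂ) := by
  apply (Function.LeftInverse.injective (g := eigenCoord h) (f := fun B =>
    (h.eigenvectorUnitary : Matrix n n ℂ) * B * (h.eigenvectorUnitary : Matrix n n ℂ)ᴴ)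
    (eigenCoord_conj h))
  simp only [conj_eigenCoord]
  exact h.spectral_theorem

theorem trace_conjTranspose_mul_eq_sum (h : ρ.IsHermitian) (A B : Matrix n n ℂ) :
    (Aᴴ * B).trace = ∑ i, ∑ j, star (eigenCoord h A i j) * eigenCoord h B i j := by
  rw [← trace_eigenCoord h, eigenCoord_mul, eigenCoord_conjTranspose, Finset.sum_comm]
  simp [Matrix.trace, Matrix.mul_apply]

open Classical in
/-- The double operator sum `∑_{i,j} F(λ i, λ j) ⟨φ i, B φ j⟩ |φ i⟩⟨φ j|` on the support of
`ρ = ∑ i, λ i • |φ i⟩⟨φ i|`. -/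
noncomputable def doubleOperator (F : ℝ → ℝ → ℂ) (h : ρ.IsHermitian) (B : Matrix n n ℂ) :
    Matrix n n ℂ :=
  (h.eigenvectorUnitary : Matrix n n ℂ) *
    (Matrix.of fun i j =>
      (if 0 < h.eigenvalues i ∧ 0 < h.eigenvalues j then
        F (h.eigenvalues i) (h.eigenvalues j) else 0) * eigenCoord h B i j) *
    (h.eigenvectorUnitary : Matrix n n ℂ)ᴴ

open Classical in
theorem eigenCoord_doubleOperator (F : ℝ → ℝ → ℂ) (h : ρ.IsHermitian) (B : Matrix n n ℂ)
    (i j : n) : eigenCoord h (doubleOperator F h B) i j =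
      (if 0 < h.eigenvalues i ∧ 0 < h.eigenvalues j then
        F (h.eigenvalues i) (h.eigenvalues j) else 0) * eigenCoord h B i j := by
  rw [doubleOperator, eigenCoord_conj, Matrix.of_apply]

theorem doubleOperator_doubleOperator (F G : ℝ → ℝ → ℂ) (h : ρ.IsHermitian)
    (B : Matrix n n ℂ) : doubleOperator F h (doubleOperator G h B) =
      doubleOperator (fun x y => F x y * G x y) h B := by
  classical
  apply eigenCoord_injective h
  ext i j
  simp only [eigenCoord_doubleOperator]
  split_ifs <;> simp [mul_assoc]

theorem doubleOperator_congr {F G : ℝ → ℝ → ℂ} (h : ρ.IsHermitian) (B : Matrix n n ℂ)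
    (hFG : ∀ x y, 0 < x → 0 < y → F x y = G x y) :
    doubleOperator F h B = doubleOperator G h B := by
  classical
  apply eigenCoord_injective h
  ext i j
  simp only [eigenCoord_doubleOperator]
  split_ifs with hij
  · rw [hFG _ _ hij.1 hij.2]
  · rfl

theorem doubleOperator_one (hρ : ρ.PosDef) (B : Matrix n n ℂ) :
    doubleOperator (fun _ _ => 1) hρ.isHermitian B = B := by
  classical
  apply eigenCoord_injective hρ.isHermitian
  ext i j
  simp [eigenCoord_doubleOperator, hρ.eigenvalues_pos]

/-- The operator `f(L_ρ R_ρ⁻¹) R_ρ⁻¹` is the double operator sum of `f(x / y) / y`. -/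
theorem metricOperator_eq_doubleOperator (g : ℝ → ℝ) (h : ρ.IsHermitian) (B : Matrix n n ℂ) :
    metricOperator g ρ B = doubleOperator (fun x y => (y : ℂ)⁻¹ * (g (x / y) : ℂ)) h B := by
  simp [metricOperator, h, doubleOperator, eigenCoord]

theorem matPow_mul_mul_matPow (h : ρ.IsHermitian) (z w : ℂ) (B : Matrix n n ℂ) :
    matPow ρ z * B * matPow ρ w = doubleOperator (fun x y => (x : ℂ) ^ z * (y : ℂ) ^ w) h B := by
  classical
  apply eigenCoord_injective h
  ext i j
  rw [eigenCoord_doubleOperator, eigenCoord_mul, eigenCoord_mul]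
  simp only [matPow, h, dif_pos, eigenCoord_conj, Matrix.mul_diagonal, Matrix.diagonal_mul]
  by_cases hi : 0 < h.eigenvalues i <;> by_cases hj : 0 < h.eigenvalues j <;> simp [hi, hj]
  ring

end DoubleOperator

/-! ### Variational formula for the inverse of `a R_ρ + b L_ρ` -/

section Variational

variable {n : Type*} [Fintype n] [DecidableEq n] {ρ : Matrix n n ℂ}

/-- `A` is supported on the support of `ρ`, on both sides. -/
def IsSupportedOn (A : Matrix n n ℂ) (h : ρ.IsHermitian) : Prop :=
  ∀ i j, h.eigenvalues i = 0 ∨ h.eigenvalues j = 0 → eigenCoord h A i j = 0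

theorem isSupportedOn_of_posDef (hρ : ρ.PosDef) (A : Matrix n n ℂ) :
    IsSupportedOn A hρ.isHermitian := by
  intro i j hij
  exact (hij.elim (hρ.eigenvalues_pos i).ne' (hρ.eigenvalues_pos j).ne').elim

/-- The quadratic form of `a R_ρ + b L_ρ`. -/
noncomputable def mulForm (a b : ℝ) (ρ Y : Matrix n n ℂ) : ℝ :=
  a * (ρ * (Yᴴ * Y)).trace.re + b * (ρ * (Y * Yᴴ)).trace.re

/-- The inverse `(a R_ρ + b L_ρ)⁻¹` on the support of `ρ`. -/
noncomputable def resolventOperator (a b : ℝ) (h : ρ.IsHermitian) (A : Matrix n n ℂ) :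
    Matrix n n ℂ :=
  doubleOperator (fun x y => (((a * y + b * x)⁻¹ : ℝ) : ℂ)) h A

/-- The quadratic form of `(a R_ρ + b L_ρ)⁻¹` on the support of `ρ`. -/
noncomputable def resolventForm (a b : ℝ) (h : ρ.IsHermitian) (A : Matrix n n ℂ) : ℝ :=
  (Aᴴ * resolventOperator a b h A).trace.re

theorem mulForm_eq_sum (a b : ℝ) (h : ρ.IsHermitian) (Y : Matrix n n ℂ) :
    mulForm a b ρ Y = ∑ i, ∑ j, (a * h.eigenvalues j + b * h.eigenvalues i) *
      Complex.normSq (eigenCoord h Y i j) := by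
  have h1 : (ρ * (Yᴴ * Y)).trace.re
      = ∑ i, ∑ j, h.eigenvalues j * Complex.normSq (eigenCoord h Y i j) := by
    rw [← trace_eigenCoord h, eigenCoord_mul, eigenCoord_mul, eigenCoord_conjTranspose,
      eigenCoord_self, Finset.sum_comm]
    simp only [Matrix.trace, Matrix.diag, Matrix.diagonal_mul]
    simp [Matrix.mul_apply, Finset.mul_sum, Complex.normSq_apply]
  have h2 : (ρ * (Y * Yᴴ)).trace.re
      = ∑ i, ∑ j, h.eigenvalues i * Complex.normSq (eigenCoord h Y i j) := by
    rw [← trace_eigenCoord h, eigenCoord_mul, eigenCoord_mul, eigenCoord_conjTranspose,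
      eigenCoord_self]
    simp only [Matrix.trace, Matrix.diag, Matrix.diagonal_mul]
    simp [Matrix.mul_apply, Finset.mul_sum, Complex.normSq_apply]
  simp only [mulForm, h1, h2, Finset.mul_sum, ← Finset.sum_add_distrib, add_mul, mul_assoc]

open Classical in
theorem resolventForm_eq_sum (a b : ℝ) (h : ρ.IsHermitian) (A : Matrix n n ℂ) :
    resolventForm a b h A = ∑ i, ∑ j,
      (if 0 < h.eigenvalues i ∧ 0 < h.eigenvalues j then
        (a * h.eigenvalues j + b * h.eigenvalues i)⁻¹ else 0) *
      Complex.normSq (eigenCoord h A i j) := by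
  rw [resolventForm, trace_conjTranspose_mul_eq_sum h, Complex.re_sum]
  refine Finset.sum_congr rfl fun i _ => ?_
  rw [Complex.re_sum]
  refine Finset.sum_congr rfl fun j _ => ?_
  rw [resolventOperator, eigenCoord_doubleOperator]
  split_ifs
  · rw [mul_left_comm, Complex.re_ofReal_mul]
    simp [Complex.normSq_apply]
  · simp

/-- Completing the square in the variational formula for the resolvent form. -/
theorem resolventForm_sub (hρ : ρ.PosSemidef) {a b : ℝ} (ha : 0 ≤ a) (hb : 0 ≤ b)
    (hab : 0 < a + b) {A : Matrix n n ℂ} (hA : IsSupportedOn A hρ.isHermitian)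
    (Y : Matrix n n ℂ) :
    resolventForm a b hρ.isHermitian A - 2 * (Aᴴ * Y).trace.re + mulForm a b ρ Y =
      mulForm a b ρ (Y - resolventOperator a b hρ.isHermitian A) := by
  classical
  set h := hρ.isHermitian
  rw [mulForm_eq_sum a b h, mulForm_eq_sum a b h, resolventForm_eq_sum,
    trace_conjTranspose_mul_eq_sum h, Complex.re_sum, Finset.mul_sum, ← Finset.sum_sub_distrib,
    ← Finset.sum_add_distrib]
  refine Finset.sum_congr rfl fun i _ => ?_
  rw [Complex.re_sum, Finset.mul_sum, ← Finset.sum_sub_distrib, ← Finset.sum_add_distrib]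
  refine Finset.sum_congr rfl fun j _ => ?_
  have e : eigenCoord h (Y - resolventOperator a b h A) i j =
      eigenCoord h Y i j - eigenCoord h (resolventOperator a b h A) i j := by
    simp [eigenCoord, Matrix.mul_sub, Matrix.sub_mul]
  rw [e, resolventOperator, eigenCoord_doubleOperator]
  have hi : 0 ≤ h.eigenvalues i := hρ.eigenvalues_nonneg i
  have hj : 0 ≤ h.eigenvalues j := hρ.eigenvalues_nonneg j
  have hs := hA i j
  generalize eigenCoord h A i j = α at *
  generalize eigenCoord h Y i j = y at *
  generalize h.eigenvalues i = x at *
  generalize h.eigenvalues j = z at *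
  -- Entrywise, with weight `w = a z + b x > 0`, this is `|α|² / w - 2 Re (ᾱ y) + w |y|² = w |y - α
  -- / w|²`. Off the support `α` vanishes and only the terms in `y` remain.
  split_ifs with hxz
  · have hw : 0 < a * z + b * x := by
      obtain ⟨hx, hz⟩ := hxz
      rcases ha.eq_or_lt with rfl | ha
      · have : 0 < b := by simpa using hab
        positivity
      · positivity
    generalize a * z + b * x = w at *
    simp only [Complex.normSq_apply, Complex.sub_re, Complex.sub_im, Complex.mul_re,
      Complex.mul_im, Complex.ofReal_re, Complex.ofReal_im, RCLike.star_def, Complex.conj_re, Complex.conj_im]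
    field_simp
    ring
  · have h0 : α = 0 := by
      apply hs
      rw [not_and_or, not_lt, not_lt] at hxz
      exact hxz.imp (le_antisymm · hi) (le_antisymm · hj)
    simp [h0]

theorem mulForm_nonneg (hρ : ρ.PosSemidef) {a b : ℝ} (ha : 0 ≤ a) (hb : 0 ≤ b)
    (Y : Matrix n n ℂ) : 0 ≤ mulForm a b ρ Y := by
  rw [mulForm_eq_sum a b hρ.isHermitian]
  refine Finset.sum_nonneg fun i _ => Finset.sum_nonneg fun j _ => ?_
  have hi := hρ.eigenvalues_nonneg i
  have hj := hρ.eigenvalues_nonneg j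
  have := Complex.normSq_nonneg (eigenCoord hρ.isHermitian Y i j)
  positivity

theorem eq_zero_of_mulForm_nonpos (hρ : ρ.PosDef) {a b : ℝ} (ha : 0 ≤ a) (hb : 0 ≤ b)
    (hab : 0 < a + b) {Y : Matrix n n ℂ} (hY : mulForm a b ρ Y ≤ 0) : Y = 0 := by
  have h0 := le_antisymm hY (mulForm_nonneg hρ.posSemidef ha hb Y)
  have hw : ∀ i j, 0 < a * hρ.isHermitian.eigenvalues j + b * hρ.isHermitian.eigenvalues i := by
    intro i j
    have hi := hρ.eigenvalues_pos i
    have hj := hρ.eigenvalues_pos j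
    rcases ha.eq_or_lt with rfl | ha
    · have : 0 < b := by simpa using hab
      positivity
    · positivity
  rw [mulForm_eq_sum a b hρ.isHermitian] at h0
  have hn : ∀ i j, 0 ≤ (a * hρ.isHermitian.eigenvalues j + b * hρ.isHermitian.eigenvalues i) *
      Complex.normSq (eigenCoord hρ.isHermitian Y i j) :=
    fun i j => mul_nonneg (hw i j).le (Complex.normSq_nonneg _)
  apply eigenCoord_injective hρ.isHermitian
  ext i j
  have h1 := (Finset.sum_eq_zero_iff_of_nonneg
    (fun i _ => Finset.sum_nonneg fun j _ => hn i j)).1 h0 i (Finset.mem_univ _)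
  have h2 := (Finset.sum_eq_zero_iff_of_nonneg (fun j _ => hn i j)).1 h1 j (Finset.mem_univ _)
  simpa [(hw i j).ne', eigenCoord] using h2

/-- The optimal value in the variational formula is attained at the resolvent. -/
theorem mulForm_resolventOperator (hρ : ρ.PosSemidef) {a b : ℝ} (ha : 0 ≤ a)
    (hb : 0 ≤ b) (hab : 0 < a + b) {A : Matrix n n ℂ} (hA : IsSupportedOn A hρ.isHermitian) :
    mulForm a b ρ (resolventOperator a b hρ.isHermitian A) =
      resolventForm a b hρ.isHermitian A := by
  have h := resolventForm_sub hρ ha hb hab hA (resolventOperator a b hρ.isHermitian A)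
  rw [sub_self] at h
  have h0 : mulForm a b ρ 0 = 0 := by simp [mulForm]
  rw [h0] at h
  have e : (Aᴴ * resolventOperator a b hρ.isHermitian A).trace.re
    = resolventForm a b hρ.isHermitian A := rfl
  rw [e] at h
  linarith

end Variational

/-! ### Monotonicity of the resolvent forms and its equality case -/

section DataProcessing

variable {n m : Type*} [Fintype n] [DecidableEq n] [Fintype m] [DecidableEq m]
  {ρ : Matrix n n ℂ} {Φ : Matrix n n ℂ →ₗ[ℂ] Matrix m m ℂ}

theorem IsQuantumChannel.isCompletelyPositive (hΦ : IsQuantumChannel Φ) :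
    IsCompletelyPositive Φ := hΦ.completelyPositive

theorem IsCompletelyPositive.map_posSemidef (hΦ : IsCompletelyPositive Φ) (hρ : ρ.PosSemidef) :
    (Φ ρ).PosSemidef := by
  have h := (hΦ 1 (ρ.submatrix Prod.snd Prod.snd) (hρ.submatrix _)).submatrix
    (fun i : m => ((0 : Fin 1), i))
  exact h

theorem IsQuantumChannel.trace_mul_le (hΦ : IsQuantumChannel Φ) (hρ : ρ.PosSemidef)
    (X : Matrix m m ℂ) :
    (ρ * ((hsAdjoint Φ X)ᴴ * hsAdjoint Φ X)).trace.re ≤ (Φ ρ * (Xᴴ * X)).trace.re := by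
  have hσ := hΦ.isCompletelyPositive.map_posSemidef hρ
  have h := trace_mul_nonneg hρ
    (hΦ.isCompletelyPositive.hsAdjoint.schwarz (hsAdjoint_one hΦ.tracePreserving) X)
  rw [Matrix.mul_sub, Matrix.trace_sub, ← trace_map_mul hρ.isHermitian hσ.isHermitian,
    Complex.nonneg_iff, Complex.sub_re] at h
  linarith [h.1]

/-- The `R` part is the traced Schwarz inequality for `X`, the `L` part the same inequality for
`X*`. -/
theorem IsQuantumChannel.mulForm_hsAdjoint_le (hΦ : IsQuantumChannel Φ) (hρ : ρ.PosSemidef)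
    {a b : ℝ} (ha : 0 ≤ a) (hb : 0 ≤ b) (X : Matrix m m ℂ) :
    mulForm a b ρ (hsAdjoint Φ X) ≤ mulForm a b (Φ ρ) X := by
  have h1 := hΦ.trace_mul_le hρ X
  have h2 := hΦ.trace_mul_le hρ Xᴴ
  rw [hΦ.isCompletelyPositive.hsAdjoint.map_conjTranspose, conjTranspose_conjTranspose,
    conjTranspose_conjTranspose] at h2
  exact add_le_add (mul_le_mul_of_nonneg_left h1 ha) (mul_le_mul_of_nonneg_left h2 hb)

theorem IsQuantumChannel.hsAdjoint_eq_zero (hΦ : IsQuantumChannel Φ) (hρ : ρ.PosDef)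
    {a b : ℝ} (ha : 0 ≤ a) (hb : 0 ≤ b) (hab : 0 < a + b) {X : Matrix m m ℂ}
    (hX : mulForm a b (Φ ρ) X = 0) : hsAdjoint Φ X = 0 :=
  eq_zero_of_mulForm_nonpos hρ ha hb hab
    ((hΦ.mulForm_hsAdjoint_le hρ.posSemidef ha hb X).trans hX.le)

/-- The image of any matrix under `Φ` is supported on the support of `Φ ρ`, for faithful `ρ`. -/
theorem IsQuantumChannel.isSupportedOn (hΦ : IsQuantumChannel Φ) (hρ : ρ.PosDef)
    (hσ : (Φ ρ).IsHermitian) (A : Matrix n n ℂ) : IsSupportedOn (Φ A) hσ := by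
  intro i j hij
  -- A matrix unit in the eigenbasis of `Φ ρ`. If one of its two eigenvalues is zero, the form of
  -- `L` or of `R` vanishes on it, so `Φ†` kills it; pairing with `A` then reads off the entry of `Φ
  -- A`.
  let X : Matrix m m ℂ := (hσ.eigenvectorUnitary : Matrix m m ℂ) * Matrix.single i j 1 *
    (hσ.eigenvectorUnitary : Matrix m m ℂ)ᴴ
  have hX : eigenCoord hσ X = Matrix.single i j 1 := eigenCoord_conj hσ _
  have h0 : hsAdjoint Φ X = 0 := by
    have hm : ∀ a b : ℝ, mulForm a b (Φ ρ) X
        = a * hσ.eigenvalues j + b * hσ.eigenvalues i := by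
      intro a b
      rw [mulForm_eq_sum a b hσ, hX, Finset.sum_eq_single i, Finset.sum_eq_single j]
      · simp
      · intro k _ hk
        simp [hk.symm]
      · simp
      · intro k _ hk
        simp [hk.symm]
      · simp
    rcases hij with hi | hj
    · exact hΦ.hsAdjoint_eq_zero (a := 0) (b := 1) hρ le_rfl zero_le_one (by simp)
        (by simp [hm, hi])
    · exact hΦ.hsAdjoint_eq_zero (a := 1) (b := 0) hρ zero_le_one le_rfl (by simp)
        (by simp [hm, hj])
  have h1 := trace_hsAdjoint Φ A X
  rw [h0, trace_conjTranspose_mul_eq_sum hσ, hX, Finset.sum_eq_single i,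
    Finset.sum_eq_single j] at h1
  · simpa using h1
  · intro k _ hk
    simp [hk.symm]
  · simp
  · intro k _ hk
    simp [hk.symm]
  · simp

/-- `Φ† X`, with `X` the optimizer for `Φ A`, serves as trial point in the variational problem for
`A`. The cross term equals the form at `Φ A` by duality, and the form of `Φ† X` is at most that of
`X`, which is again the form at `Φ A`. -/
theorem IsQuantumChannel.mulForm_sub_le (hΦ : IsQuantumChannel Φ) (hρ : ρ.PosSemidef)
    (hσ : (Φ ρ).PosSemidef) {a b : ℝ} (ha : 0 ≤ a) (hb : 0 ≤ b) (hab : 0 < a + b)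
    {A : Matrix n n ℂ} (hA : IsSupportedOn A hρ.isHermitian)
    (hA' : IsSupportedOn (Φ A) hσ.isHermitian) :
    mulForm a b ρ (hsAdjoint Φ (resolventOperator a b hσ.isHermitian (Φ A)) -
        resolventOperator a b hρ.isHermitian A) ≤
      resolventForm a b hρ.isHermitian A - resolventForm a b hσ.isHermitian (Φ A) := by
  set X := resolventOperator a b hσ.isHermitian (Φ A) with hX
  rw [← resolventForm_sub hρ ha hb hab hA, ← trace_hsAdjoint]
  have h1 := hΦ.mulForm_hsAdjoint_le hρ ha hb X
  have h2 := mulForm_resolventOperator hσ ha hb hab hA'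
  have e : ((Φ A)ᴴ * X).trace.re = resolventForm a b hσ.isHermitian (Φ A) := rfl
  rw [← hX] at h2
  linarith

/-- Monotonicity of the resolvent metrics. -/
theorem IsQuantumChannel.resolventForm_le (hΦ : IsQuantumChannel Φ) (hρ : ρ.PosSemidef)
    (hσ : (Φ ρ).PosSemidef) {a b : ℝ} (ha : 0 ≤ a) (hb : 0 ≤ b) (hab : 0 < a + b)
    {A : Matrix n n ℂ} (hA : IsSupportedOn A hρ.isHermitian)
    (hA' : IsSupportedOn (Φ A) hσ.isHermitian) :
    resolventForm a b hσ.isHermitian (Φ A) ≤ resolventForm a b hρ.isHermitian A :=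
  sub_nonneg.1 ((mulForm_nonneg hρ ha hb _).trans (hΦ.mulForm_sub_le hρ hσ ha hb hab hA hA'))

/-- The equality case in the monotonicity of the resolvent metrics. -/
theorem IsQuantumChannel.resolventOperator_eq (hΦ : IsQuantumChannel Φ) (hρ : ρ.PosDef)
    (hσ : (Φ ρ).PosSemidef) {a b : ℝ} (ha : 0 ≤ a) (hb : 0 ≤ b) (hab : 0 < a + b)
    {A : Matrix n n ℂ}
    (h : resolventForm a b hρ.isHermitian A = resolventForm a b hσ.isHermitian (Φ A)) :
    resolventOperator a b hρ.isHermitian A =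
      hsAdjoint Φ (resolventOperator a b hσ.isHermitian (Φ A)) := by
  have h1 := hΦ.mulForm_sub_le hρ.posSemidef hσ ha hb hab (isSupportedOn_of_posDef hρ A)
    (hΦ.isSupportedOn hρ hσ.isHermitian A)
  exact (sub_eq_zero.1 (eq_zero_of_mulForm_nonpos hρ ha hb hab
    (h1.trans (sub_nonpos.2 h.le)))).symm

end DataProcessing
-- Resolvents determine functionals on finitely many points
section PartialFractions

open Polynomial in
/-- Partial fractions with distinct poles are linearly independent on any infinite set. -/
theorem eq_zero_of_sum_div_eq_zero {R : Finset ℝ} (hR : ∀ r ∈ R, 0 < r) {S : Set ℝ}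
    (hS : S.Infinite) (hS0 : ∀ s ∈ S, 0 < s) (w : ℝ → ℂ)
    (h : ∀ s ∈ S, ∑ r ∈ R, w r * (((s + r)⁻¹ : ℝ) : ℂ) = 0) : ∀ r ∈ R, w r = 0 := by
  classical
  -- The numerator after clearing denominators: it has infinitely many roots, hence is zero, and its
  -- value at `-r` isolates `w r`.
  let p : ℂ[X] := ∑ r ∈ R, C (w r) * ∏ r' ∈ R.erase r, (X + C (r' : ℂ))
  have hp : p = 0 := by
    refine eq_zero_of_infinite_isRoot p
      ((hS.image Complex.ofReal_injective.injOn).mono ?_)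
    rintro _ ⟨s, hs, rfl⟩
    have e : p.eval (s : ℂ) =
        (∏ r ∈ R, ((s : ℂ) + r)) * ∑ r ∈ R, w r * (((s + r)⁻¹ : ℝ) : ℂ) := by
      simp only [p, eval_finsetSum, eval_mul, eval_C, eval_prod, eval_add, eval_X,
        Finset.mul_sum]
      refine Finset.sum_congr rfl fun r hr => ?_
      rw [← Finset.mul_prod_erase R _ hr]
      have : (s : ℂ) + r ≠ 0 := by
        exact_mod_cast (add_pos (hS0 s hs) (hR r hr)).ne'
      push_cast
      field_simp
    rw [Set.mem_ofPred_eq, IsRoot, e, h s hs, mul_zero]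
  intro r hr
  have e : p.eval (-(r : ℂ)) = w r * ∏ r' ∈ R.erase r, (-(r : ℂ) + r') := by
    simp only [p, eval_finsetSum, eval_mul, eval_C, eval_prod, eval_add, eval_X]
    refine Finset.sum_eq_single_of_mem r hr fun r' _ hne => ?_
    rw [Finset.prod_eq_zero (Finset.mem_erase.2 ⟨hne.symm, hr⟩) (by simp), mul_zero]
  rw [hp, eval_zero] at e
  refine (mul_eq_zero.1 e.symm).resolve_right (Finset.prod_ne_zero_iff.2 fun r' hr' => ?_)
  rw [neg_add_eq_sub, sub_ne_zero]
  exact_mod_cast (Finset.mem_erase.1 hr').1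

/-- A linear functional on functions that depends only on finitely many positive points
vanishes if it vanishes on the functions `1 / (s + x)` for infinitely many `s > 0`. -/
theorem linearMap_eq_zero_of_resolvents (L : (ℝ → ℂ) →ₗ[ℂ] ℂ) {R : Finset ℝ}
    (hR : ∀ r ∈ R, 0 < r) (hL : ∀ f : ℝ → ℂ, (∀ r ∈ R, f r = 0) → L f = 0) {S : Set ℝ}
    (hS : S.Infinite) (hS0 : ∀ s ∈ S, 0 < s)
    (h : ∀ s ∈ S, L (fun x => (((s + x)⁻¹ : ℝ) : ℂ)) = 0) : L = 0 := by
  classical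
  have e : ∀ f, L f = ∑ r ∈ R, L (Pi.single r 1) * f r := by
    intro f
    have h0 := hL (f - ∑ r ∈ R, f r • Pi.single r 1) (fun r hr => by
      rw [Pi.sub_apply, Finset.sum_apply, Finset.sum_eq_single_of_mem r hr]
      · simp
      · intro r' _ hne
        simp [hne.symm])
    rw [map_sub, sub_eq_zero, map_sum] at h0
    rw [h0]
    exact Finset.sum_congr rfl fun r _ => by rw [map_smul, smul_eq_mul, mul_comm]
  have hw := eq_zero_of_sum_div_eq_zero hR hS hS0 (fun r => L (Pi.single r 1))
    (fun s hs => by rw [← h s hs, e])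
  ext1 f
  rw [e, LinearMap.zero_apply]
  exact Finset.sum_eq_zero fun r hr => by rw [hw r hr, zero_mul]

end PartialFractions

/-! ### From resolvents to all functions, and to recovery -/

section Sufficiency

variable {n m : Type*} [Fintype n] [DecidableEq n] [Fintype m] [DecidableEq m]
  {ρ : Matrix n n ℂ} {Φ : Matrix n n ℂ →ₗ[ℂ] Matrix m m ℂ}

/-- The operator `f(L_ρ R_ρ⁻¹) R_ρ⁻¹ B`, as a linear function of `f`. -/
noncomputable def quotientOperator (h : ρ.IsHermitian) (B : Matrix n n ℂ) :
    (ℝ → ℂ) →ₗ[ℂ] Matrix n n ℂ where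
  toFun f := doubleOperator (fun x y => (y : ℂ)⁻¹ * f (x / y)) h B
  map_add' f g := by
    classical
    apply eigenCoord_injective h
    have e : ∀ C D : Matrix n n ℂ, eigenCoord h (C + D) = eigenCoord h C + eigenCoord h D := by
      simp [eigenCoord, Matrix.mul_add, Matrix.add_mul]
    ext i j
    rw [e, Matrix.add_apply]
    simp only [eigenCoord_doubleOperator, Pi.add_apply]
    split_ifs <;> ring
  map_smul' c f := by
    classical
    apply eigenCoord_injective h
    have e : ∀ C : Matrix n n ℂ, eigenCoord h (c • C) = c • eigenCoord h C := by
      simp [eigenCoord]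
    ext i j
    rw [RingHom.id_apply, e, Matrix.smul_apply]
    simp only [eigenCoord_doubleOperator, Pi.smul_apply, smul_eq_mul]
    split_ifs <;> ring

theorem quotientOperator_apply (h : ρ.IsHermitian) (B : Matrix n n ℂ) (f : ℝ → ℂ) :
    quotientOperator h B f = doubleOperator (fun x y => (y : ℂ)⁻¹ * f (x / y)) h B := rfl

theorem exists_finset_quotientOperator_eq_zero (h : ρ.IsHermitian) (B : Matrix n n ℂ) :
    ∃ R : Finset ℝ, (∀ r ∈ R, 0 < r) ∧
      ∀ f : ℝ → ℂ, (∀ r ∈ R, f r = 0) → quotientOperator h B f = 0 := by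
  classical
  refine ⟨(Finset.univ.image fun ij : n × n =>
    h.eigenvalues ij.1 / h.eigenvalues ij.2).filter (0 < ·), by simp, fun f hf => ?_⟩
  apply eigenCoord_injective h
  ext i j
  rw [quotientOperator_apply, eigenCoord_doubleOperator]
  split_ifs with hij
  · rw [hf]
    · simp [eigenCoord]
    · simpa using div_pos hij.1 hij.2
  · simp [eigenCoord]

theorem resolventOperator_eq_quotientOperator (s : ℝ) (h : ρ.IsHermitian)
    (B : Matrix n n ℂ) : resolventOperator s 1 h B =
      quotientOperator h B fun x => (((s + x)⁻¹ : ℝ) : ℂ) := by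
  rw [quotientOperator_apply, resolventOperator]
  refine doubleOperator_congr h B fun x y _ hy => ?_
  have e : (s * y + 1 * x)⁻¹ = y⁻¹ * (s + x / y)⁻¹ := by
    rw [← mul_inv]
    congr 1
    field_simp
  rw [e, Complex.ofReal_mul, Complex.ofReal_inv y]

/-- `f(L_ρ R_ρ⁻¹) R_ρ⁻¹ A = Φ†(f(L_σ R_σ⁻¹) R_σ⁻¹ Φ(A))` for all functions `f`,
where `σ = Φ ρ`. -/
def IsSufficient (hρ : ρ.IsHermitian) (Φ : Matrix n n ℂ →ₗ[ℂ] Matrix m m ℂ)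
    (hσ : (Φ ρ).IsHermitian) (A : Matrix n n ℂ) : Prop :=
  ∀ f : ℝ → ℂ, quotientOperator hρ A f = hsAdjoint Φ (quotientOperator hσ (Φ A) f)

/-- Each matrix entry of the difference of the two sides is linear in `f` and depends on `f` only at
the eigenvalue ratios of `ρ` and of `Φ ρ`, so `linearMap_eq_zero_of_resolvents` applies. -/
theorem isSufficient_of_resolventOperator_eq {hρ : ρ.IsHermitian} {hσ : (Φ ρ).IsHermitian}
    {A : Matrix n n ℂ} {S : Set ℝ} (hS : S.Infinite) (hS0 : ∀ s ∈ S, 0 < s)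
    (h : ∀ s ∈ S, resolventOperator s 1 hρ A =
      hsAdjoint Φ (resolventOperator s 1 hσ (Φ A))) : IsSufficient hρ Φ hσ A := by
  classical
  obtain ⟨R₁, hR₁, h₁⟩ := exists_finset_quotientOperator_eq_zero hρ A
  obtain ⟨R₂, hR₂, h₂⟩ := exists_finset_quotientOperator_eq_zero hσ (Φ A)
  intro f
  ext k l
  let L : (ℝ → ℂ) →ₗ[ℂ] ℂ := Matrix.entryLinearMap ℂ ℂ k l ∘ₗ
    (quotientOperator hρ A - hsAdjoint Φ ∘ₗ quotientOperator hσ (Φ A))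
  have hL : L = 0 := by
    refine linearMap_eq_zero_of_resolvents L (R := R₁ ∪ R₂) ?_ ?_ hS hS0 ?_
    · intro r hr
      exact (Finset.mem_union.1 hr).elim (hR₁ r) (hR₂ r)
    · intro f hf
      simp [L, h₁ f fun r hr => hf r (Finset.mem_union_left _ hr),
        h₂ f fun r hr => hf r (Finset.mem_union_right _ hr)]
    · intro s hs
      have := h s hs
      rw [resolventOperator_eq_quotientOperator, resolventOperator_eq_quotientOperator] at this
      simp only [L, LinearMap.comp_apply, LinearMap.sub_apply, this, sub_self, map_zero]
  exact sub_eq_zero.1 (LinearMap.congr_fun hL f)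

theorem IsSufficient.metric_eq {hρ : ρ.IsHermitian} {hσ : (Φ ρ).IsHermitian}
    {A : Matrix n n ℂ} (h : IsSufficient hρ Φ hσ A) (g : ℝ → ℝ) :
    metric g ρ A = metric g (Φ ρ) (Φ A) := by
  rw [metric, metric, metricForm, metricForm, metricOperator_eq_doubleOperator g hρ,
    metricOperator_eq_doubleOperator g hσ, trace_hsAdjoint]
  exact congrArg (fun B => (Aᴴ * B).trace) (h fun x => (g x : ℂ))

/-- For `f = x ^ (-1/2 + it)` the operator `f(L R⁻¹) R⁻¹` is the sandwich by the powers `-1/2 ± it`.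
The outer powers of `ρ` in the Petz map undo it on the left side of the sufficiency identity. -/
theorem IsSufficient.rotatedPetz_eq (hρ : ρ.PosDef) {hσ : (Φ ρ).IsHermitian}
    {A : Matrix n n ℂ} (h : IsSufficient hρ.isHermitian Φ hσ A) (t : ℝ) :
    A = rotatedPetz ρ Φ t (Φ A) := by
  have key : ∀ x y : ℝ, 0 < x → 0 < y → (y : ℂ)⁻¹ * ((x / y : ℝ) : ℂ) ^
      (-1 / 2 + t * Complex.I : ℂ) = (x : ℂ) ^ (-1 / 2 + t * Complex.I : ℂ) *
        (y : ℂ) ^ (-1 / 2 - t * Complex.I : ℂ) := by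
    intro x y hx hy
    have hx' : (x : ℂ) ≠ 0 := by exact_mod_cast hx.ne'
    have hy' : (y : ℂ) ≠ 0 := by exact_mod_cast hy.ne'
    rw [div_eq_mul_inv, Complex.ofReal_mul, Complex.mul_cpow_ofReal_nonneg hx.le
      (inv_nonneg.2 hy.le), Complex.ofReal_inv, mul_left_comm]
    congr 1
    rw [Complex.inv_cpow _ _ (by rw [Complex.arg_ofReal_of_nonneg hy.le]; exact Real.pi_pos.ne),
      ← Complex.cpow_neg, ← Complex.cpow_neg_one, ← Complex.cpow_add _ _ hy']
    congr 1
    ring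
  have hf := h fun x => (x : ℂ) ^ (-1 / 2 + t * Complex.I : ℂ)
  rw [quotientOperator_apply, quotientOperator_apply, doubleOperator_congr _ _ key,
    doubleOperator_congr _ _ key, ← matPow_mul_mul_matPow hσ] at hf
  rw [rotatedPetz, ← hf, matPow_mul_mul_matPow hρ.isHermitian, doubleOperator_doubleOperator]
  refine ((doubleOperator_congr _ _ fun x y hx hy => ?_).trans (doubleOperator_one hρ A)).symm
  have hx' : (x : ℂ) ≠ 0 := by exact_mod_cast hx.ne'
  have hy' : (y : ℂ) ≠ 0 := by exact_mod_cast hy.ne'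
  rw [mul_mul_mul_comm, ← Complex.cpow_add _ _ hx', ← Complex.cpow_add _ _ hy']
  ring_nf
  simp

/-- The resolvent form decreases from `A` to `Φ A` and again from `Φ A` to `R (Φ A) = A`, so it is
constant for every `s > 0`. -/
theorem IsQuantumChannel.isSufficient_of_channel (hΦ : IsQuantumChannel Φ) (hρ : ρ.PosDef)
    (hσ : (Φ ρ).PosSemidef) {R : Matrix m m ℂ →ₗ[ℂ] Matrix n n ℂ} (hR : IsQuantumChannel R)
    {A : Matrix n n ℂ} (hRρ : ρ = R (Φ ρ)) (hRA : A = R (Φ A)) :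
    IsSufficient hρ.isHermitian Φ hσ.isHermitian A := by
  refine isSufficient_of_resolventOperator_eq (Set.Ioi_infinite (0 : ℝ)) (fun s hs => hs)
    fun s hs => ?_
  have hs0 : (0 : ℝ) ≤ s := le_of_lt hs
  have hs1 : 0 < s + 1 := by positivity
  have hA := isSupportedOn_of_posDef hρ A
  have hA' := hΦ.isSupportedOn hρ hσ.isHermitian A
  -- The forms are attached to a proof that the state is Hermitian, so `ρ = R (Φ ρ)` is used by
  -- substituting a free variable `τ`.
  have transport : ∀ {τ : Matrix n n ℂ} (hτ : τ.PosDef) (B : Matrix n n ℂ), ρ = τ → A = B →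
      resolventForm s 1 hτ.isHermitian B = resolventForm s 1 hρ.isHermitian A ∧
        IsSupportedOn B hτ.isHermitian := by
    rintro τ hτ B rfl rfl
    exact ⟨rfl, hA⟩
  have hτ : (R (Φ ρ)).PosDef := hRρ ▸ hρ
  obtain ⟨e, hB⟩ := transport hτ _ hRρ hRA
  have h := hR.resolventForm_le hσ hτ.posSemidef hs0 zero_le_one hs1 hA' hB
  exact hΦ.resolventOperator_eq hρ hσ hs0 zero_le_one hs1
    (le_antisymm (e ▸ h) (hΦ.resolventForm_le hρ.posSemidef hσ hs0 zero_le_one hs1 hA hA'))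

end Sufficiency

/-! ### Equality for one regular metric -/

section Regular

variable {n m : Type*} [Fintype n] [DecidableEq n] [Fintype m] [DecidableEq m]
  {ρ : Matrix n n ℂ} {Φ : Matrix n n ℂ →ₗ[ℂ] Matrix m m ℂ}

open Classical in
theorem metric_re_eq_sum (g : ℝ → ℝ) (h : ρ.IsHermitian) (A : Matrix n n ℂ) :
    (metric g ρ A).re = ∑ i, ∑ j, (if 0 < h.eigenvalues i ∧ 0 < h.eigenvalues j then
      (h.eigenvalues j)⁻¹ * g (h.eigenvalues i / h.eigenvalues j) else 0) *
      Complex.normSq (eigenCoord h A i j) := by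
  rw [metric, metricForm, metricOperator_eq_doubleOperator g h,
    trace_conjTranspose_mul_eq_sum h, Complex.re_sum]
  refine Finset.sum_congr rfl fun i _ => ?_
  rw [Complex.re_sum]
  refine Finset.sum_congr rfl fun j _ => ?_
  rw [eigenCoord_doubleOperator]
  split_ifs
  · rw [mul_left_comm, ← Complex.ofReal_inv, ← Complex.ofReal_mul, Complex.re_ofReal_mul]
    simp [Complex.normSq_apply]
  · simp

theorem IsRepresentedBy.integrable_resolventForm {g : ℝ → ℝ} {c : ℝ} {ν : Measure ℝ}
    (hg : IsRepresentedBy g c ν) (h : ρ.IsHermitian) (A : Matrix n n ℂ) :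
    Integrable (fun s => resolventForm s 1 h A) ν ∧
      (metric g ρ A).re = c * resolventForm 1 0 h A + ∫ s, resolventForm s 1 h A ∂ν := by
  classical
  have hinv : ∀ x y s : ℝ, 0 < y → (s * y + 1 * x)⁻¹ = y⁻¹ * (1 / (s + x / y)) := by
    intro x y s hy
    rw [one_div, ← mul_inv]
    congr 1
    field_simp
  have hi : ∀ i j, Integrable (fun s => (if 0 < h.eigenvalues i ∧ 0 < h.eigenvalues j then
      (s * h.eigenvalues j + 1 * h.eigenvalues i)⁻¹ else 0) *
      Complex.normSq (eigenCoord h A i j)) ν := by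
    intro i j
    refine Integrable.mul_const ?_ _
    split_ifs with hij
    · simp only [hinv _ _ _ hij.2]
      exact (hg.integrable _ (div_pos hij.1 hij.2)).const_mul _
    · exact integrable_zero _ _ _
  simp only [resolventForm_eq_sum]
  refine ⟨integrable_finsetSum _ fun i _ => integrable_finsetSum _ fun j _ => hi i j, ?_⟩
  rw [integral_finsetSum _ fun i _ => integrable_finsetSum _ fun j _ => hi i j,
    metric_re_eq_sum g h, Finset.mul_sum, ← Finset.sum_add_distrib]
  refine Finset.sum_congr rfl fun i _ => ?_
  rw [integral_finsetSum _ fun j _ => hi i j, Finset.mul_sum, ← Finset.sum_add_distrib]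
  refine Finset.sum_congr rfl fun j _ => ?_
  rw [integral_mul_const, ← mul_assoc, ← add_mul]
  congr 1
  split_ifs with hij
  · simp only [hinv _ _ _ hij.2]
    rw [hg.eq _ (div_pos hij.1 hij.2), integral_const_mul]
    ring
  · simp

/-- The loss of the metric is the `ν`-integral of the nonnegative losses of the resolvent forms plus
a nonnegative multiple `c` of another one. If it vanishes, so does the resolvent loss `ν`-almost
everywhere, hence Lebesgue almost everywhere on `(0, ∞)`. -/
theorem IsQuantumChannel.isSufficient_of_metric_eq (hΦ : IsQuantumChannel Φ) (hρ : ρ.PosDef)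
    (hσ : (Φ ρ).PosSemidef) {g : ℝ → ℝ} (hg : IsRegular g) {A : Matrix n n ℂ}
    (h : metric g ρ A = metric g (Φ ρ) (Φ A)) :
    IsSufficient hρ.isHermitian Φ hσ.isHermitian A := by
  obtain ⟨c, ν, hν, hac⟩ := hg
  have hA := isSupportedOn_of_posDef hρ A
  have hA' := hΦ.isSupportedOn hρ hσ.isHermitian A
  have hle : ∀ {a b : ℝ}, 0 ≤ a → 0 ≤ b → 0 < a + b →
      resolventForm a b hσ.isHermitian (Φ A) ≤ resolventForm a b hρ.isHermitian A :=
    fun ha hb hab => hΦ.resolventForm_le hρ.posSemidef hσ ha hb hab hA hA'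
  obtain ⟨i1, e1⟩ := hν.integrable_resolventForm hρ.isHermitian A
  obtain ⟨i2, e2⟩ := hν.integrable_resolventForm hσ.isHermitian (Φ A)
  have hnn : 0 ≤ᵐ[ν] fun s => resolventForm s 1 hρ.isHermitian A -
      resolventForm s 1 hσ.isHermitian (Φ A) := by
    have hs : ∀ᵐ s ∂ν, s ∉ Set.Iio (0 : ℝ) := measure_eq_zero_iff_ae_notMem.1 hν.support
    filter_upwards [hs] with s hs
    have hs0 : 0 ≤ s := not_lt.1 hs
    exact sub_nonneg.2 (hle hs0 zero_le_one (by positivity))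
  have hz : ∫ s, (resolventForm s 1 hρ.isHermitian A -
      resolventForm s 1 hσ.isHermitian (Φ A)) ∂ν = 0 := by
    refine le_antisymm ?_ (integral_nonneg_of_ae hnn)
    rw [integral_sub i1 i2]
    have h10 := mul_le_mul_of_nonneg_left
      (hle (a := 1) (b := 0) zero_le_one le_rfl (by norm_num)) hν.nonneg
    have := congrArg Complex.re h
    linarith
  have hae := hac ((integral_eq_zero_iff_of_nonneg_ae hnn (i1.sub i2)).1 hz)
  refine isSufficient_of_resolventOperator_eq
    (S := {s | 0 < s ∧ resolventForm s 1 hρ.isHermitian A -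
      resolventForm s 1 hσ.isHermitian (Φ A) = 0}) ?_ (fun s hs => hs.1) fun s hs =>
      hΦ.resolventOperator_eq hρ hσ hs.1.le zero_le_one (add_pos hs.1 one_pos)
        (sub_eq_zero.1 hs.2)
  -- A finite set is Lebesgue null, whereas almost every `s > 0` lies in this one.
  intro hfin
  have h0 : ∀ᵐ s ∂(volume.restrict (Set.Ioi (0 : ℝ))), s ∉ _ :=
    measure_eq_zero_iff_ae_notMem.1 (Measure.restrict_le_self.absolutelyContinuous
      (hfin.measure_zero volume))
  have hF : ∀ᵐ s ∂(volume.restrict (Set.Ioi (0 : ℝ))), False := by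
    filter_upwards [hae, h0, ae_restrict_mem measurableSet_Ioi] with s h1 h2 h3
    exact h2 ⟨h3, h1⟩
  rw [Filter.eventually_false_iff_eq_bot, ae_eq_bot, Measure.restrict_eq_zero,
    Real.volume_Ioi] at hF
  exact ENNReal.top_ne_zero hF

end Regular
-- The regular symmetric normalized metric of `x ^ (-1/2)`
section InverseSquareRoot

open scoped MatrixOrder Matrix.Norms.L2Operator in
theorem isMonotoneMetricFunction_rpow_neg_half :
    IsMonotoneMetricFunction fun x => x ^ (-(1 / 2) : ℝ) where
  pos x hx := Real.rpow_pos_of_pos hx _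
  operatorAntitone k A B hA hB hAB := by
    have hA' : IsStrictlyPositive A := hA.isStrictlyPositive
    have hB' : IsStrictlyPositive B := hB.isStrictlyPositive
    have h1 : A ^ (1 / 2 : ℝ) ≤ B ^ (1 / 2 : ℝ) :=
      CFC.monotone_rpow ⟨by norm_num, by norm_num⟩ hAB
    have h2 := CStarAlgebra.rpow_neg_one_le_rpow_neg_one h1 (hA'.rpow A _)
    rw [CFC.rpow_rpow A _ _ (by norm_num) hA', CFC.rpow_rpow B _ _ (by norm_num) hB',
      CFC.rpow_eq_cfc_real hA'.nonneg, CFC.rpow_eq_cfc_real hB'.nonneg] at h2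
    have e : (1 / 2 : ℝ) * -1 = -(1 / 2) := by norm_num
    rw [e] at h2
    exact h2

theorem isSymmetricNormalized_rpow_neg_half :
    IsSymmetricNormalized fun x => x ^ (-(1 / 2) : ℝ) where
  symm x hx := by
    rw [← Real.rpow_neg_one x, ← Real.rpow_mul hx.le, ← Real.rpow_one_add' hx.le (by norm_num)]
    norm_num
  map_one := Real.one_rpow _

-- Dividing the integral formula for `x ^ (1/2)` by `x` gives `x ^ (-1/2) = C⁻¹ ∫ s ^ (-1/2) / (s +
-- x) ds`. The density is strictly positive on `(0, ∞)`, which yields the required absolute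
-- continuity.
open Real Set in
theorem isRegular_rpow_neg_half : IsRegular fun x => x ^ (-(1 / 2) : ℝ) := by
  have hp : (1 / 2 : ℝ) ∈ Ioo (0 : ℝ) 1 := ⟨by norm_num, by norm_num⟩
  set C : ℝ := ∫ t in Ioi 0, rpowIntegrand₀₁ (1 / 2) t 1 with hC
  have hC0 : 0 < C := integral_rpowIntegrand₀₁_one_pos hp
  let d : ℝ → NNReal := fun s => (C⁻¹ * s ^ (-(1 / 2) : ℝ)).toNNReal
  have hd : Measurable d := by fun_prop
  have hval : ∀ x : ℝ, 0 < x → ∀ s ∈ Ioi (0 : ℝ), d s • (1 / (s + x)) =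
      (C⁻¹ * x⁻¹) * rpowIntegrand₀₁ (1 / 2) s x := by
    intro x hx s hs
    have hs0 : 0 < s := hs
    rw [rpowIntegrand₀₁_eq_pow_div hp hs0.le hx.le, NNReal.smul_def,
      Real.coe_toNNReal _ (by positivity), smul_eq_mul]
    norm_num
    field_simp
  refine ⟨0, (volume.restrict (Ioi (0 : ℝ))).withDensity fun s => d s, ⟨le_rfl, ?_, ?_, ?_⟩, ?_⟩
  · refine withDensity_absolutelyContinuous _ _ ?_
    rw [Measure.restrict_apply measurableSet_Iio, Iio_inter_Ioi, Ioo_self, measure_empty]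
  · intro x hx
    rw [integrable_withDensity_iff_integrable_smul hd]
    refine ((integrableOn_rpowIntegrand₀₁_Ioi hp hx.le).const_mul (C⁻¹ * x⁻¹)).congr ?_
    filter_upwards [ae_restrict_mem measurableSet_Ioi] with s hs
    exact (hval x hx s hs).symm
  · intro x hx
    rw [integral_withDensity_eq_integral_smul hd, setIntegral_congr_fun measurableSet_Ioi
      (hval x hx), integral_const_mul, mul_right_comm, ← rpow_eq_const_mul_integral hp hx.le,
      zero_add, ← div_eq_mul_inv, ← Real.rpow_sub_one hx.ne']
    norm_num
  · refine withDensity_absolutelyContinuous' hd.coe_nnreal_ennreal.aemeasurable ?_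
    filter_upwards [ae_restrict_mem measurableSet_Ioi] with s hs
    have hs0 : 0 < s := hs
    have : 0 < C⁻¹ * s ^ (-(1 / 2) : ℝ) := by positivity
    simpa [d] using this

end InverseSquareRoot

/-! ### Completing the rotated Petz map to a channel -/

section Recovery

variable {n m : Type*} [Fintype n] [DecidableEq n] [Fintype m] [DecidableEq m]
  {ρ : Matrix n n ℂ} {Φ : Matrix n n ℂ →ₗ[ℂ] Matrix m m ℂ}

theorem matPow_mul_matPow (h : ρ.IsHermitian) (z w : ℂ) :
    matPow ρ z * matPow ρ w = matPow ρ (z + w) := by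
  classical
  apply eigenCoord_injective h
  rw [eigenCoord_mul]
  simp only [matPow, h, dif_pos, eigenCoord_conj, Matrix.diagonal_mul_diagonal]
  congr 1
  ext i
  split_ifs with hi
  · rw [Complex.cpow_add]
    exact_mod_cast hi.ne'
  · simp

theorem matPow_one (hρ : ρ.PosSemidef) : matPow ρ 1 = ρ := by
  classical
  apply eigenCoord_injective hρ.isHermitian
  rw [eigenCoord_self]
  simp only [matPow, hρ.isHermitian, dif_pos, eigenCoord_conj]
  congr 1
  ext i
  split_ifs with hi
  · simp
  · rw [le_antisymm (not_lt.1 hi) (hρ.eigenvalues_nonneg i), Complex.ofReal_zero]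

theorem matPow_conjTranspose (h : ρ.IsHermitian) (z : ℂ) :
    (matPow ρ z)ᴴ = matPow ρ (star z) := by
  classical
  apply eigenCoord_injective h
  rw [eigenCoord_conjTranspose]
  simp only [matPow, h, dif_pos, eigenCoord_conj, Matrix.diagonal_conjTranspose]
  congr 1
  ext i
  rw [Pi.star_apply]
  split_ifs with hi
  · simp only [RCLike.star_def]
    rw [Complex.cpow_conj _ _ (by
      rw [Complex.arg_ofReal_of_nonneg hi.le]; exact Real.pi_pos.ne), Complex.conj_ofReal]
  · simp

theorem matPow_conjTranspose' (h : ρ.IsHermitian) (c t : ℝ) :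
    (matPow ρ (c + t * Complex.I))ᴴ = matPow ρ (c - t * Complex.I) := by
  rw [matPow_conjTranspose h]
  simp [sub_eq_add_neg]

/-- The projection onto the kernel of `ρ`. -/
noncomputable def kernelProjection (ρ : Matrix n n ℂ) : Matrix n n ℂ := 1 - matPow ρ 0

theorem kernelProjection_isHermitian (h : ρ.IsHermitian) :
    (kernelProjection ρ)ᴴ = kernelProjection ρ := by
  simp [kernelProjection, matPow_conjTranspose h]

theorem kernelProjection_mul_self (h : ρ.IsHermitian) :
    kernelProjection ρ * kernelProjection ρ = kernelProjection ρ := by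
  simp [kernelProjection, Matrix.mul_sub, Matrix.sub_mul, matPow_mul_matPow h]

theorem mul_kernelProjection (hρ : ρ.PosSemidef) : ρ * kernelProjection ρ = 0 := by
  have h := matPow_mul_matPow hρ.isHermitian 1 0
  rw [add_zero, matPow_one hρ] at h
  rw [kernelProjection, Matrix.mul_sub, h, Matrix.mul_one, sub_self]

theorem IsQuantumChannel.hsAdjoint_kernelProjection (hΦ : IsQuantumChannel Φ) (hρ : ρ.PosDef)
    (hσ : (Φ ρ).PosSemidef) : hsAdjoint Φ (kernelProjection (Φ ρ)) = 0 := by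
  refine hΦ.hsAdjoint_eq_zero (a := 1) (b := 0) hρ zero_le_one le_rfl (by norm_num) ?_
  rw [mulForm, kernelProjection_isHermitian hσ.isHermitian,
    kernelProjection_mul_self hσ.isHermitian, mul_kernelProjection hσ]
  simp

/-- The rotated Petz map, made trace preserving on the kernel of `Φ ρ`. -/
noncomputable def recoveryMap (ρ : Matrix n n ℂ) (Φ : Matrix n n ℂ →ₗ[ℂ] Matrix m m ℂ) (t : ℝ) :
    Matrix m m ℂ →ₗ[ℂ] Matrix n n ℂ :=
  conjMap (matPow ρ (1 / 2 - t * Complex.I)) ∘ₗ hsAdjoint Φ ∘ₗ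
      conjMap (matPow (Φ ρ) (-1 / 2 + t * Complex.I)) +
    traceMap ρ ∘ₗ conjMap (kernelProjection (Φ ρ))

theorem recoveryMap_apply (hρ : ρ.IsHermitian) (hσ : (Φ ρ).IsHermitian) (t : ℝ)
    (X : Matrix m m ℂ) : recoveryMap ρ Φ t X =
      rotatedPetz ρ Φ t X + (kernelProjection (Φ ρ) * X).trace • ρ := by
  have h1 : (matPow ρ (1 / 2 - t * Complex.I))ᴴ = matPow ρ (1 / 2 + t * Complex.I) := by
    simpa [sub_eq_add_neg] using matPow_conjTranspose' hρ (1 / 2) (-t)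
  have h2 : (matPow (Φ ρ) (-1 / 2 + t * Complex.I))ᴴ =
      matPow (Φ ρ) (-1 / 2 - t * Complex.I) := by
    simpa using matPow_conjTranspose' hσ (-1 / 2) t
  simp only [recoveryMap, rotatedPetz, LinearMap.add_apply, LinearMap.comp_apply, conjMap_apply,
    traceMap_apply, h1, h2]
  rw [kernelProjection_isHermitian hσ, Matrix.trace_mul_comm, ← Matrix.mul_assoc,
    kernelProjection_mul_self hσ]

/-- In the trace, the Petz part contributes `X` on the support of `Φ ρ` and the added part
contributes `X` on the kernel, since `ρ` has trace one. -/
theorem IsQuantumChannel.recoveryMap_isQuantumChannel (hΦ : IsQuantumChannel Φ)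
    (hρ : IsFaithfulState ρ) (hσ : (Φ ρ).PosSemidef) (t : ℝ) :
    IsQuantumChannel (recoveryMap ρ Φ t) where
  completelyPositive :=
    ((isCompletelyPositive_conjMap _).comp (hΦ.isCompletelyPositive.hsAdjoint.comp
      (isCompletelyPositive_conjMap _))).add
      ((isCompletelyPositive_traceMap hρ.posDef.posSemidef).comp
        (isCompletelyPositive_conjMap _))
  tracePreserving X := by
    rw [recoveryMap_apply hρ.posDef.isHermitian hσ.isHermitian, Matrix.trace_add,
      Matrix.trace_smul, hρ.trace_eq_one, smul_eq_mul, mul_one, rotatedPetz,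
      Matrix.trace_mul_comm, ← Matrix.mul_assoc, matPow_mul_matPow hρ.posDef.isHermitian,
      add_add_sub_cancel, add_halves, matPow_one hρ.posDef.posSemidef,
      ← trace_map_mul hρ.posDef.isHermitian hσ.isHermitian, ← Matrix.mul_assoc,
      Matrix.trace_mul_comm, ← Matrix.mul_assoc, ← Matrix.mul_assoc]
    -- With `Φ ρ` written as a first power, the three exponents sum to zero, leaving the support
    -- projection `matPow (Φ ρ) 0`.
    nth_rw 2 [← matPow_one hσ]
    rw [matPow_mul_matPow hσ.isHermitian, matPow_mul_matPow hσ.isHermitian,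
      ← Matrix.trace_add, ← Matrix.add_mul, kernelProjection]
    have e : (-1 / 2 - t * Complex.I + 1 + (-1 / 2 + t * Complex.I) : ℂ) = 0 := by ring
    rw [e, add_sub_cancel, Matrix.one_mul]

/-- The correction term pairs `Φ A` with the kernel projection, and `Φ†` annihilates that projection
because `ρ` is faithful. -/
theorem IsQuantumChannel.recoveryMap_map (hΦ : IsQuantumChannel Φ) (hρ : ρ.PosDef)
    (hσ : (Φ ρ).PosSemidef) (t : ℝ) (A : Matrix n n ℂ) :
    recoveryMap ρ Φ t (Φ A) = rotatedPetz ρ Φ t (Φ A) := by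
  have h := trace_hsAdjoint Φ A (kernelProjection (Φ ρ))
  rw [hΦ.hsAdjoint_kernelProjection hρ hσ, Matrix.mul_zero, Matrix.trace_zero,
    ← kernelProjection_isHermitian hσ.isHermitian, ← Matrix.conjTranspose_mul,
    Matrix.trace_conjTranspose, star_eq_zero] at h
  rw [recoveryMap_apply hρ.isHermitian hσ.isHermitian, h, zero_smul, add_zero]

/-- The inner sandwich collapses to the support projection of `Φ ρ`. It differs from `1` by a
projection killed by `Φ†`, so its image is `1`. -/
theorem IsQuantumChannel.rotatedPetz_map_state (hΦ : IsQuantumChannel Φ) (hρ : ρ.PosDef)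
    (hσ : (Φ ρ).PosSemidef) (t : ℝ) : rotatedPetz ρ Φ t (Φ ρ) = ρ := by
  have e1 : (-1 / 2 + t * Complex.I + 1 + (-1 / 2 - t * Complex.I) : ℂ) = 0 := by ring
  have e2 : (1 / 2 - t * Complex.I + (1 / 2 + t * Complex.I) : ℂ) = 1 := by ring
  have e3 : matPow (Φ ρ) (-1 / 2 + t * Complex.I) * Φ ρ * matPow (Φ ρ) (-1 / 2 - t * Complex.I)
      = 1 - kernelProjection (Φ ρ) := by
    nth_rw 2 [← matPow_one hσ]
    rw [matPow_mul_matPow hσ.isHermitian, matPow_mul_matPow hσ.isHermitian, e1,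
      kernelProjection, sub_sub_cancel]
  rw [rotatedPetz, e3, map_sub, hsAdjoint_one hΦ.tracePreserving,
    hΦ.hsAdjoint_kernelProjection hρ hσ, sub_zero, Matrix.mul_one,
    matPow_mul_matPow hρ.isHermitian, e2, matPow_one hρ.posSemidef]

end Recovery
end QuantumMetric

/-! ### The cycle of implications -/

theorem theorem4p5 {n m : Type*} [Fintype n] [DecidableEq n] [Fintype m] [DecidableEq m]
    (ρ : Matrix n n ℂ) (hρ : QuantumMetric.IsFaithfulState ρ)
    (Φ : Matrix n n ℂ →ₗ[ℂ] Matrix m m ℂ) (hΦ : QuantumMetric.IsQuantumChannel Φ)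
    (A : Matrix n n ℂ) :
    List.TFAE [
      -- equality for all monotone metrics
      ∀ g : ℝ → ℝ, QuantumMetric.IsMonotoneMetricFunction g →
        QuantumMetric.metric g ρ A = QuantumMetric.metric g (Φ ρ) (Φ A),
      -- equality for all symmetric normalized monotone metrics
      ∀ g : ℝ → ℝ, QuantumMetric.IsMonotoneMetricFunction g →
        QuantumMetric.IsSymmetricNormalized g →
        QuantumMetric.metric g ρ A = QuantumMetric.metric g (Φ ρ) (Φ A),
      -- equality for some regular monotone metric
      ∃ g : ℝ → ℝ, QuantumMetric.IsMonotoneMetricFunction g ∧ QuantumMetric.IsRegular g ∧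
        QuantumMetric.metric g ρ A = QuantumMetric.metric g (Φ ρ) (Φ A),
      -- equality for some regular symmetric normalized monotone metric
      ∃ g : ℝ → ℝ, QuantumMetric.IsMonotoneMetricFunction g ∧
        QuantumMetric.IsSymmetricNormalized g ∧ QuantumMetric.IsRegular g ∧
        QuantumMetric.metric g ρ A = QuantumMetric.metric g (Φ ρ) (Φ A),
      -- recovery of `A` by the rotated Petz map for some `t`
      ∃ t : ℝ, A = QuantumMetric.rotatedPetz ρ Φ t (Φ A),
      -- recovery of `A` by the rotated Petz map for all `t`
      ∀ t : ℝ, A = QuantumMetric.rotatedPetz ρ Φ t (Φ A),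
      -- recovery of both `ρ` and `A` by a channel
      ∃ R : Matrix m m ℂ →ₗ[ℂ] Matrix n n ℂ, QuantumMetric.IsQuantumChannel R ∧
        ρ = R (Φ ρ) ∧ A = R (Φ A)] := by
  have hσ := hΦ.isCompletelyPositive.map_posSemidef hρ.posDef.posSemidef
  tfae_have 1 → 2 := fun h g hg _ => h g hg
  tfae_have 2 → 4 := fun h =>
    ⟨_, QuantumMetric.isMonotoneMetricFunction_rpow_neg_half,
      QuantumMetric.isSymmetricNormalized_rpow_neg_half, QuantumMetric.isRegular_rpow_neg_half,
      h _ QuantumMetric.isMonotoneMetricFunction_rpow_neg_half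
        QuantumMetric.isSymmetricNormalized_rpow_neg_half⟩
  tfae_have 4 → 3 := fun ⟨g, hg, _, hr, h⟩ => ⟨g, hg, hr, h⟩
  tfae_have 3 → 6 := fun ⟨_, _, hr, h⟩ =>
    (hΦ.isSufficient_of_metric_eq hρ.posDef hσ hr h).rotatedPetz_eq hρ.posDef
  tfae_have 6 → 5 := fun h => ⟨0, h 0⟩
  tfae_have 5 → 7 := fun ⟨t, ht⟩ =>
    ⟨QuantumMetric.recoveryMap ρ Φ t, hΦ.recoveryMap_isQuantumChannel hρ hσ t,
      ((hΦ.recoveryMap_map hρ.posDef hσ t ρ).trans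
        (hΦ.rotatedPetz_map_state hρ.posDef hσ t)).symm,
      ht.trans (hΦ.recoveryMap_map hρ.posDef hσ t A).symm⟩
  tfae_have 7 → 1 := fun ⟨_, hR, h1, h2⟩ g _ =>
    (hΦ.isSufficient_of_channel hρ.posDef hσ hR h1 h2).metric_eq g
  tfae_finish
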